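/- Let $R$ be an associative ring with identity; all modules are unital left $R$-modules. For a cardinal $\kappa$, the notation $i<\kappa$ means that $i$ runs over the ordinals below the initial ordinal of $\kappa$, and $cf$ denotes cofinality. A module $M$ is *tailwise $\kappa$-slender* (t$\kappa$-slender) if for every family of cyclic modules $Ra_i$ ($i<\kappa$) and every homomorphism $f:\prod_{i<\kappa}Ra_i\to M$ there is $i_0<\kappa$ such that $f\left(\prod_{i\ge i_0}Ra_i\right)=0$. It is *slender* if for every countably infinite index set $I$, every family of modules $A_i$ ($i\in I$) and every homomorphism $f:\prod_{i\in I}A_i\to M$, the restriction $f|_{A_i}$ is non-zero for only finitely many $i$. A cardinal $\kappa$ is *measurable* here if there is a countably complete non-principal ultrafilter on a set of cardinality $\kappa$. Then: 1. The trivial module $0$ is t$\kappa$-slender for every cardinal $\kappa\ne 0$. 2. For every cardinal $\kappa$, a module $M$ is t$\kappa$-slender if and only if every submodule $N\le M$ is t$\kappa$-slender. 3. For every infinite non-measurable cardinal $\kappa$, every slender $R$-module is t$\kappa$-slender. 4. If $R\neq 0$, then $R^\kappa$ is not t$\kappa$-slender, for every cardinal $\kappa$. 5. Let $\kappa$ and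 $\lambda$ be cardinals with $\kappa<cf\,\lambda$, and let $B_j$ ($j<\kappa$) be $R$-modules. Then $\prod_{j<\kappa}B_j$ is t$\lambda$-slender if and only if every $B_j$ is t$\lambda$-slender, and $\bigoplus_{j<\kappa}B_j$ is t$\lambda$-slender if and only if every $B_j$ is t$\lambda$-slender. In particular, if $\kappa\neq 0$, then $R^\kappa$ is t$\lambda$-slender if and only if $R$ is t$\lambda$-slender. 6. For every cardinal $\kappa$, if $0\to A\xrightarrow{\alpha}B\xrightarrow{\beta}C\to 0$ is an exact sequence of $R$-modules and $A$ and $C$ are t$\kappa$-slender, then $B$ is t$\kappa$-slender. -/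

import Mathlib

open Cardinal DirectSum

universe u

/-- Coordinatewise `κ`-slenderness of a left `R`-module `M`: for every index set `I` of
cardinality `κ`, every family of `R`-modules `A i` and every morphism `f : ∏ A i → M`, fewer
than `κ` of the restrictions of `f` to the coordinate submodules `A i` are non-zero. -/
def IsKappaSlender (κ : Cardinal.{u}) (R : Type u) [Ring R]
    (M : Type u) [AddCommGroup M] [Module R M] : Prop :=
  open Classical in
  ∀ (I : Type u), #I = κ →
    ∀ (A : I → Type u) [∀ i, AddCommGroup (A i)] [∀ i, Module R (A i)]
      (f : (∀ i, A i) →ₗ[R] M),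
      #{i : I // f ∘ₗ LinearMap.single R A i ≠ 0} < κ

/-- A slender module is an `ℵ₀`-slender module. -/
def IsSlender (R : Type u) [Ring R] (M : Type u) [AddCommGroup M] [Module R M] : Prop :=
  IsKappaSlender ℵ₀ R M

/-- Tailwise `κ`-slenderness: for every morphism `f : ∏_{i < κ} R a_i → M` out of a product of
cyclic modules there is `i₀ < κ` such that `f` vanishes on the tail `∏_{i ≥ i₀} R a_i`, that is,
on all vectors whose coordinates below `i₀` are zero. The indices `i < κ` are the elements of the
well-ordered type of the initial ordinal of `κ`. -/
def IsTailSlender (κ : Cardinal.{u}) (R : Type u) [Ring R]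
    (M : Type u) [AddCommGroup M] [Module R M] : Prop :=
  ∀ (A : κ.ord.ToType → Type u) [∀ i, AddCommGroup (A i)] [∀ i, Module R (A i)]
    (a : ∀ i, A i) (f : (∀ i, Submodule.span R {a i}) →ₗ[R] M),
    ∃ i₀ : κ.ord.ToType, ∀ x : (∀ i, Submodule.span R {a i}),
      (∀ i, i < i₀ → x i = 0) → f x = 0

/-- A cardinal `κ` is measurable (in the sense of Ulam, as is usual in the theory of slender
modules) if a set of cardinality `κ` carries a countably complete non-principal ultrafilter. -/
def IsMeasurableCardinal (κ : Cardinal.{u}) : Prop :=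
  ∃ U : Ultrafilter κ.ord.ToType,
    CountableInterFilter (U : Filter κ.ord.ToType) ∧ ∀ i, U ≠ pure i

section Slender

variable {R : Type u} [Ring R] {M : Type u} [AddCommGroup M] [Module R M]

/-! The deep clause is that slender implies tailwise slender. For `f` into a slender module, the
null sets of coordinates form a σ-ideal (`IsNullFor.iUnion`), and disjoint non-null sets cannot form
an infinite sequence. So only finitely many singletons are non-null. Were the rest non-null, it
would contain an atom (`IsSlender.exists_atom`), whose ultrafilter is countably complete and
non-principal, which makes `κ` measurable. Hence `f` kills everything off a finite, thus bounded,
set. The other clauses combine thresholds: a bound below the cofinality for products, a maximum for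
extensions. -/

theorem IsTailSlender.of_injective {κ : Cardinal.{u}} {N : Type u} [AddCommGroup N] [Module R N]
    (h : IsTailSlender κ R M) (g : N →ₗ[R] M) (hg : Function.Injective g) :
    IsTailSlender κ R N := by
  intro A _ _ a f
  obtain ⟨i₀, hi₀⟩ := h A a (g ∘ₗ f)
  exact ⟨i₀, fun x hx => hg (by simpa using hi₀ x hx)⟩

theorem isTailSlender_of_subsingleton {κ : Cardinal.{u}} (hκ : κ ≠ 0) [Subsingleton M] :
    IsTailSlender κ R M := by
  intro A _ _ a f
  have := nonempty_ord_toType hκ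
  exact ⟨Classical.arbitrary _, fun x _ => Subsingleton.elim _ _⟩

/-- A family indexed by a cardinal smaller than the cofinality is bounded. -/
theorem exists_forall_le_of_lt_cof {κ μ : Cardinal.{u}} (h : κ < μ.ord.cof)
    (i : κ.ord.ToType → μ.ord.ToType) : ∃ b, ∀ j, i j ≤ b := by
  by_contra! hb
  have hc : IsCofinal (Set.range i) := fun b => by
    obtain ⟨j, hj⟩ := hb b
    exact ⟨i j, ⟨j, rfl⟩, hj.le⟩
  have h1 := Order.cof_le hc
  have h2 : #(Set.range i) ≤ κ := by simpa using (Cardinal.mk_range_le (f := i))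
  have h3 : Order.cof μ.ord.ToType = μ.ord.cof := by simp
  exact absurd (h3 ▸ h1.trans h2) (not_le.2 h)

theorem isTailSlender_pi {κ μ : Cardinal.{u}} (h : κ < μ.ord.cof)
    {B : κ.ord.ToType → Type u} [∀ j, AddCommGroup (B j)] [∀ j, Module R (B j)]
    (hB : ∀ j, IsTailSlender μ R (B j)) : IsTailSlender μ R (∀ j, B j) := by
  intro A _ _ a f
  choose i hi using fun j => hB j A a (LinearMap.proj j ∘ₗ f)
  obtain ⟨b, hb⟩ := exists_forall_le_of_lt_cof h i
  exact ⟨b, fun x hx => funext fun j => hi j x fun k hk => hx k (hk.trans_le (hb j))⟩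

theorem isTailSlender_pi_iff {κ μ : Cardinal.{u}} (h : κ < μ.ord.cof)
    (B : κ.ord.ToType → Type u) [∀ j, AddCommGroup (B j)] [∀ j, Module R (B j)] :
    IsTailSlender μ R (∀ j, B j) ↔ ∀ j, IsTailSlender μ R (B j) :=
  ⟨fun hB j => hB.of_injective (LinearMap.single R B j) (Pi.single_injective j),
    isTailSlender_pi h⟩

theorem isTailSlender_directSum_iff {κ μ : Cardinal.{u}} (h : κ < μ.ord.cof)
    (B : κ.ord.ToType → Type u) [∀ j, AddCommGroup (B j)] [∀ j, Module R (B j)] :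
    IsTailSlender μ R (⨁ j, B j) ↔ ∀ j, IsTailSlender μ R (B j) :=
  ⟨fun hB j => hB.of_injective (DirectSum.lof R _ B j) (DirectSum.of_injective j),
    fun hB => (isTailSlender_pi h hB).of_injective (DFinsupp.coeFnLinearMap R)
      DFunLike.coe_injective⟩

theorem not_isTailSlender_pi [Nontrivial R] (κ : Cardinal.{u}) :
    ¬ IsTailSlender κ R (κ.ord.ToType → R) := by
  intro h
  -- Coordinatewise inclusion: the unit vector at `i₀` lies in the tail and survives. For `κ = 0`
  -- there is no `i₀` at all.
  let f : (∀ _ : κ.ord.ToType, Submodule.span R {(1 : R)}) →ₗ[R] (κ.ord.ToType → R) :=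
    LinearMap.pi fun i => Submodule.subtype _ ∘ₗ LinearMap.proj i
  obtain ⟨i₀, hi₀⟩ := h (fun _ => R) (fun _ => 1) f
  have h0 := congrFun (hi₀ (Pi.single i₀ ⟨1, Submodule.mem_span_singleton_self 1⟩)
    fun i hi => Pi.single_eq_of_ne hi.ne _) i₀
  simp [f] at h0

/-- The endomorphism of a product that annihilates the coordinates outside of a set. -/
noncomputable def restrictCoords (R : Type u) [Ring R] {I : Type u} (A : I → Type u)
    [∀ i, AddCommGroup (A i)] [∀ i, Module R (A i)] (X : Set I) : (∀ i, A i) →ₗ[R] (∀ i, A i) :=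
  open Classical in LinearMap.pi fun i => if i ∈ X then LinearMap.proj i else 0

section restrictCoords

variable {I : Type u} {A : I → Type u} [∀ i, AddCommGroup (A i)] [∀ i, Module R (A i)]

theorem restrictCoords_of_mem {X : Set I} {i : I} (hi : i ∈ X) (x : ∀ i, A i) :
    restrictCoords R A X x i = x i := by
  simp [restrictCoords, hi]

theorem restrictCoords_of_notMem {X : Set I} {i : I} (hi : i ∉ X) (x : ∀ i, A i) :
    restrictCoords R A X x i = 0 := by
  simp [restrictCoords, hi]

theorem restrictCoords_add_compl (X : Set I) (x : ∀ i, A i) :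
    restrictCoords R A X x + restrictCoords R A Xᶜ x = x := by
  funext i
  by_cases hi : i ∈ X <;> simp [restrictCoords, hi]

end restrictCoords

theorem IsTailSlender.of_exact {κ : Cardinal.{u}} {A B C : Type u}
    [AddCommGroup A] [AddCommGroup B] [AddCommGroup C] [Module R A] [Module R B] [Module R C]
    {α : A →ₗ[R] B} {β : B →ₗ[R] C} (hα : Function.Injective α) (hαβ : Function.Exact α β)
    (hA : IsTailSlender κ R A) (hC : IsTailSlender κ R C) : IsTailSlender κ R B := by
  intro D _ _ d f
  obtain ⟨i₀, hi₀⟩ := hC D d (β ∘ₗ f)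
  -- Past `i₀` the map `β ∘ f` vanishes, so `f ∘ p` lifts through `α`.
  let p := restrictCoords R (fun i => Submodule.span R {d i}) (Set.Ici i₀)
  have hp (x) : (f ∘ₗ p) x ∈ LinearMap.range α := by
    rw [LinearMap.mem_range]
    exact (hαβ _).1 (hi₀ _ fun i hi => restrictCoords_of_notMem (not_le.2 hi) x)
  obtain ⟨i₁, hi₁⟩ := hA D d
    ((LinearEquiv.ofInjective α hα).symm.toLinearMap ∘ₗ (f ∘ₗ p).codRestrict _ hp)
  refine ⟨max i₀ i₁, fun x hx => ?_⟩
  have h1 := hi₁ x fun i hi => hx i (lt_max_of_lt_right hi)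
  have h2 : f (p x) = 0 := by
    have h3 := (LinearEquiv.map_eq_zero_iff (LinearEquiv.ofInjective α hα).symm).1 h1
    exact congrArg Subtype.val h3
  have h4 : p x = x := by
    funext i
    by_cases hi : i ∈ Set.Ici i₀
    · exact restrictCoords_of_mem hi x
    · rw [hx i (lt_max_of_lt_left (not_le.1 hi))]
      exact restrictCoords_of_notMem hi x
  rwa [h4] at h2

/-! ### Null sets of coordinates -/

section Null

variable {I : Type u} {A : I → Type u} [∀ i, AddCommGroup (A i)] [∀ i, Module R (A i)]
  {f : (∀ i, A i) →ₗ[R] M}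

/-- A morphism to a slender module is non-zero on only finitely many members of a sequence of
vectors in which each coordinate is eventually zero. -/
theorem IsSlender.finite_setOf_ne_zero (hM : IsSlender R M) (f : (∀ i, A i) →ₗ[R] M)
    (y : ℕ → ∀ i, A i) (hy : ∀ i, {n | y n i ≠ 0}.Finite) : {n | f (y n) ≠ 0}.Finite := by
  -- Sends the `n`-th unit vector to `y n`; defined on the full product because each coordinate
  -- involves finitely many `y n`.
  let g : (∀ _ : ULift.{u} ℕ, R) →ₗ[R] (∀ i, A i) := LinearMap.pi fun i =>
    ∑ n ∈ (hy i).toFinset, (LinearMap.toSpanSingleton R (A i) (y n i)) ∘ₗ LinearMap.proj ⟨n⟩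
  have hg [DecidableEq (ULift.{u} ℕ)] (n : ℕ) : g (Pi.single ⟨n⟩ 1) = y n := by
    funext i
    simp only [g, LinearMap.pi_apply, LinearMap.sum_apply, LinearMap.comp_apply,
      LinearMap.proj_apply, LinearMap.toSpanSingleton_apply]
    rw [Finset.sum_eq_single n]
    · simp
    · intro m _ hm
      rw [Pi.single_eq_of_ne (by simpa [ULift.ext_iff] using hm), zero_smul]
    · intro hn
      have : y n i = 0 := by simpa using hn
      simp [this]
  have h := hM (ULift.{u} ℕ) (by simp) (fun _ => R) (f ∘ₗ g)
  refine @Finite.of_injective {n | f (y n) ≠ 0} _ (Cardinal.lt_aleph0_iff_finite.1 h)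
    (fun n => ⟨⟨n.1⟩, fun h0 => n.2 ?_⟩) fun m n hmn => ?_
  · rw [← @hg (Classical.decEq _)]
    exact LinearMap.congr_fun h0 1
  · exact Subtype.ext (ULift.up_injective (congrArg Subtype.val hmn))

/-- A set of coordinates is null for a morphism `f` if `f` vanishes on all vectors supported
in it. -/
def IsNullFor (f : (∀ i, A i) →ₗ[R] M) (X : Set I) : Prop :=
  ∀ x : ∀ i, A i, (∀ i ∉ X, x i = 0) → f x = 0

theorem IsNullFor.mono {X Y : Set I} (hY : IsNullFor f Y) (h : X ⊆ Y) : IsNullFor f X :=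
  fun x hx => hY x fun i hi => hx i fun hX => hi (h hX)

theorem isNullFor_empty : IsNullFor f ∅ := fun x hx => by
  rw [show x = 0 from funext fun i => hx i (Set.notMem_empty i), map_zero]

theorem IsNullFor.union {X Y : Set I} (hX : IsNullFor f X) (hY : IsNullFor f Y) :
    IsNullFor f (X ∪ Y) := by
  intro x hx
  rw [← restrictCoords_add_compl (R := R) X x, map_add,
    hX _ fun i hi => restrictCoords_of_notMem hi x, zero_add]
  refine hY _ fun i hi => ?_
  by_cases hiX : i ∈ X
  · exact restrictCoords_of_notMem (Set.notMem_compl_iff.2 hiX) x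
  · rw [restrictCoords_of_mem (show i ∈ Xᶜ from hiX), hx i (by simp [hiX, hi])]

theorem IsNullFor.iUnion (hM : IsSlender R M) {X : ℕ → Set I} (hX : ∀ n, IsNullFor f (X n)) :
    IsNullFor f (⋃ n, X n) := by
  intro x hx
  by_contra h0
  have hacc (n : ℕ) : IsNullFor f (⋃ k < n, X k) := by
    induction n with
    | zero => simpa using isNullFor_empty
    | succ n ih =>
      rw [Set.biUnion_lt_succ]
      exact ih.union (hX n)
  -- Removing the first `n` pieces leaves the value `f x` unchanged, yet every coordinate of `y n`
  -- is eventually zero.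
  let y (n : ℕ) := restrictCoords R A (⋃ k < n, X k)ᶜ x
  have hfy (n : ℕ) : f (y n) = f x := by
    conv_rhs => rw [← restrictCoords_add_compl (R := R) (⋃ k < n, X k) x, map_add,
      hacc n _ fun i hi => restrictCoords_of_notMem hi x, zero_add]
  have hfin := hM.finite_setOf_ne_zero f y fun i => by
    by_cases hi : i ∈ ⋃ n, X n
    · obtain ⟨m, hm⟩ := Set.mem_iUnion.1 hi
      refine (Set.finite_Iic m).subset fun n hn => ?_
      by_contra hmn
      have him : i ∈ ⋃ k < n, X k := Set.mem_iUnion₂.2 ⟨m, not_le.1 hmn, hm⟩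
      exact hn (restrictCoords_of_notMem (Set.notMem_compl_iff.2 him) x)
    · refine Set.finite_empty.subset fun n hn => hn ?_
      have hin : i ∈ (⋃ k < n, X k)ᶜ := fun h => by
        obtain ⟨k, -, hk⟩ := Set.mem_iUnion₂.1 h
        exact hi (Set.mem_iUnion.2 ⟨k, hk⟩)
      exact (restrictCoords_of_mem hin x).trans (hx i hi)
  simp only [hfy, ne_eq, h0, not_false_eq_true, Set.ofPred_true] at hfin
  exact Set.infinite_univ hfin

theorem IsSlender.finite_setOf_not_isNullFor (hM : IsSlender R M) (f : (∀ i, A i) →ₗ[R] M)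
    {X : ℕ → Set I} (hX : Pairwise fun m n => Disjoint (X m) (X n)) :
    {n | ¬ IsNullFor f (X n)}.Finite := by
  have hex (n : ℕ) : ∃ y : ∀ i, A i, (∀ i ∉ X n, y i = 0) ∧ (¬ IsNullFor f (X n) → f y ≠ 0) := by
    by_cases h : IsNullFor f (X n)
    · exact ⟨0, fun _ _ => rfl, fun h' => (h' h).elim⟩
    · unfold IsNullFor at h
      push Not at h
      obtain ⟨y, hy, h0⟩ := h
      exact ⟨y, hy, fun _ => h0⟩
  choose y hy hfy using hex
  refine (hM.finite_setOf_ne_zero f y fun i => ?_).subset fun n hn => hfy n hn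
  refine Set.Subsingleton.finite fun m hm n hn => ?_
  by_contra hmn
  have hm' : i ∈ X m := by_contra fun h => hm (hy m i h)
  have hn' : i ∈ X n := by_contra fun h => hn (hy n i h)
  exact Set.disjoint_left.1 (hX hmn) hm' hn'

theorem IsSlender.finite_not_isNullFor_singleton (hM : IsSlender R M) (f : (∀ i, A i) →ₗ[R] M) :
    {i | ¬ IsNullFor f {i}}.Finite := by
  by_contra hinf
  let e := Set.Infinite.natEmbedding _ hinf
  have h := hM.finite_setOf_not_isNullFor f (X := fun n => {(e n : I)}) fun m n hmn =>
    Set.disjoint_singleton.2 fun h => hmn (e.injective (Subtype.ext h))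
  exact Set.infinite_univ (h.subset fun n _ => (e n).2)

/-- A non-null set contains a non-null set that is not the union of two disjoint non-null sets. -/
theorem IsSlender.exists_atom (hM : IsSlender R M) {T : Set I} (hT : ¬ IsNullFor f T) :
    ∃ P ⊆ T, ¬ IsNullFor f P ∧ ∀ Q ⊆ P, IsNullFor f Q ∨ IsNullFor f (P \ Q) := by
  by_contra! h
  choose! Q hQ using h
  -- Without atoms, endless splitting gives non-null differences `P n \ P (n + 1)`, which are
  -- pairwise disjoint.
  let P (n : ℕ) : Set I := Q^[n] T
  have hsucc (n : ℕ) : P (n + 1) = Q (P n) := Function.iterate_succ_apply' Q n T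
  have hP (n : ℕ) : P n ⊆ T ∧ ¬ IsNullFor f (P n) := by
    induction n with
    | zero => exact ⟨subset_rfl, hT⟩
    | succ n ih =>
      rw [hsucc]
      exact ⟨(hQ _ ih.1 ih.2).1.trans ih.1, (hQ _ ih.1 ih.2).2.1⟩
  have hanti : Antitone P := antitone_nat_of_succ_le fun n => by
    rw [hsucc]
    exact (hQ _ (hP n).1 (hP n).2).1
  have hfin := hM.finite_setOf_not_isNullFor f (X := fun n => P n \ P (n + 1)) <|
    (pairwise_disjoint_on _).2 fun m n hmn =>
      Set.disjoint_left.2 fun i him hin => him.2 (hanti hmn hin.1)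
  refine Set.infinite_univ (hfin.subset fun n _ => ?_)
  rw [Set.mem_ofPred_eq, hsucc]
  exact (hQ _ (hP n).1 (hP n).2).2.2

/-- The ultrafilter of the sets that meet an atom in a non-null set. -/
theorem IsSlender.exists_ultrafilter (hM : IsSlender R M) {P : Set I} (hP : ¬ IsNullFor f P)
    (hatom : ∀ Q ⊆ P, IsNullFor f Q ∨ IsNullFor f (P \ Q)) :
    ∃ U : Ultrafilter I, CountableInterFilter (U : Filter I) ∧
      ∀ X : Set I, X ∈ U ↔ IsNullFor f (P \ X) := by
  let F : Filter I :=
    { sets := {X | IsNullFor f (P \ X)}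
      univ_sets := by simpa using isNullFor_empty
      sets_of_superset := fun hX hXY => IsNullFor.mono hX (Set.sdiff_subset_sdiff_right hXY)
      inter_sets := fun {X Y} hX hY => by
        rw [Set.mem_ofPred_eq, Set.sdiff_inter]
        exact IsNullFor.union hX hY }
  have hmem (X : Set I) : X ∈ F ↔ IsNullFor f (P \ X) := Iff.rfl
  -- The atom property puts `X` or its complement in `F`; non-nullness of `P` forbids both.
  let U : Ultrafilter I := Ultrafilter.ofComplNotMemIff F fun X => by
    rw [hmem, hmem, Set.sdiff_compl]
    refine ⟨fun h => ?_, fun h h' => hP ?_⟩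
    · refine (hatom (P \ X) Set.sdiff_subset).resolve_right fun h' => h ?_
      rwa [Set.sdiff_sdiff_right_self] at h'
    · rw [← Set.sdiff_union_inter P X]
      exact h.union h'
  have hU (X : Set I) : X ∈ U ↔ IsNullFor f (P \ X) := Iff.rfl
  refine ⟨U, ⟨fun S hS hSU => ?_⟩, hU⟩
  rcases S.eq_empty_or_nonempty with rfl | hne
  · simp
  · obtain ⟨X, rfl⟩ := hS.exists_eq_range hne
    have hX (n : ℕ) : IsNullFor f (P \ X n) := (hU _).1 (hSU _ ⟨n, rfl⟩)
    have h : IsNullFor f (P \ ⋂₀ Set.range X) := by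
      rw [Set.sInter_range, Set.sdiff_iInter]
      exact IsNullFor.iUnion hM hX
    exact (hU _).2 h

end Null

theorem IsSlender.isTailSlender {κ : Cardinal.{u}} (hκ : ℵ₀ ≤ κ) (hm : ¬ IsMeasurableCardinal κ)
    (hM : IsSlender R M) : IsTailSlender κ R M := by
  intro A _ _ a f
  have hS := hM.finite_not_isNullFor_singleton f
  have hT : IsNullFor f {i | ¬ IsNullFor f {i}}ᶜ := by
    by_contra hT
    obtain ⟨P, hPT, hP, hatom⟩ := hM.exists_atom hT
    obtain ⟨U, hU, hmem⟩ := hM.exists_ultrafilter hP hatom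
    refine hm ⟨U, hU, fun i hi => ?_⟩
    -- If `U` were principal at `i`, then `P` would be null up to `i`, and no singleton inside `P`
    -- is non-null.
    have h1 : IsNullFor f (P \ {i}) := (hmem _).1 (by simp [hi])
    by_cases hiP : i ∈ P
    · have h2 : IsNullFor f {i} := not_not.1 (hPT hiP)
      exact hP ((h1.union h2).mono (by simp))
    · exact hP (h1.mono fun j hj => ⟨hj, fun h => hiP (h ▸ hj)⟩)
  -- Vanishing is needed strictly beyond the bound, so a larger index must exist.
  have : NoMaxOrder κ.ord.ToType := Cardinal.noMaxOrder hκ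
  have := nonempty_ord_toType (Cardinal.aleph0_pos.trans_le hκ).ne'
  obtain ⟨b, hb⟩ := hS.bddAbove
  obtain ⟨c, hc⟩ := exists_gt b
  exact ⟨c, fun x hx => hT x fun i hi => hx i ((hb (not_not.1 hi)).trans_lt hc)⟩

end Slender

theorem proposition9 (R : Type u) [Ring R] :
    -- the zero module
    (∀ κ : Cardinal.{u}, κ ≠ 0 →
      ∀ (M : Type u) [AddCommGroup M] [Module R M], Subsingleton M → IsTailSlender κ R M) ∧
    -- submodules
    (∀ (κ : Cardinal.{u}) (M : Type u) [AddCommGroup M] [Module R M],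
      IsTailSlender κ R M ↔ ∀ N : Submodule R M, IsTailSlender κ R N) ∧
    -- slender modules
    (∀ κ : Cardinal.{u}, ℵ₀ ≤ κ → ¬ IsMeasurableCardinal κ →
      ∀ (M : Type u) [AddCommGroup M] [Module R M], IsSlender R M → IsTailSlender κ R M) ∧
    -- the power of the ring
    (Nontrivial R → ∀ κ : Cardinal.{u}, ¬ IsTailSlender κ R (κ.ord.ToType → R)) ∧
    -- products and direct sums
    (∀ κ μ : Cardinal.{u}, κ < μ.ord.cof →
      (∀ (B : κ.ord.ToType → Type u) [∀ j, AddCommGroup (B j)] [∀ j, Module R (B j)],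
        (IsTailSlender μ R (∀ j, B j) ↔ ∀ j, IsTailSlender μ R (B j)) ∧
        (IsTailSlender μ R (⨁ j, B j) ↔ ∀ j, IsTailSlender μ R (B j))) ∧
      (κ ≠ 0 → (IsTailSlender μ R (κ.ord.ToType → R) ↔ IsTailSlender μ R R))) ∧
    -- extensions
    (∀ (κ : Cardinal.{u}) (A B C : Type u) [AddCommGroup A] [AddCommGroup B] [AddCommGroup C]
      [Module R A] [Module R B] [Module R C] (α : A →ₗ[R] B) (β : B →ₗ[R] C),
      Function.Injective α → Function.Exact α β → Function.Surjective β →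
      IsTailSlender κ R A → IsTailSlender κ R C → IsTailSlender κ R B) := by
  refine ⟨fun κ hκ M _ _ _ => isTailSlender_of_subsingleton hκ,
    fun κ M _ _ => ⟨fun h N => h.of_injective N.subtype N.injective_subtype, fun h => ?_⟩,
    fun κ hκ hm M _ _ hM => hM.isTailSlender hκ hm,
    fun _ κ => not_isTailSlender_pi κ,
    fun κ μ h => ⟨fun B _ _ => ⟨isTailSlender_pi_iff h B, isTailSlender_directSum_iff h B⟩,
      fun hκ => ?_⟩,
    fun κ A B C _ _ _ _ _ _ α β hα hαβ _ hA hC => hA.of_exact hα hαβ hC⟩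
  · exact (h ⊤).of_injective Submodule.topEquiv.symm.toLinearMap Submodule.topEquiv.symm.injective
  · have := nonempty_ord_toType hκ
    rw [isTailSlender_pi_iff h, forall_const]
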